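/- For a real-valued random variable $Z$ with characteristic function $\varphi_Z(s)=\mathbb{E}\,e^{isZ}$, define the distance variance $$\mathcal V^2(Z)=\frac1{\pi^2}\int_{\mathbb R^2}\frac{|\varphi_Z(s+t)-\varphi_Z(s)\varphi_Z(t)|^2}{s^2\,t^2}\,ds\,dt\in[0,\infty],$$ and let the distance standard deviation $\mathcal V(Z)\in[0,\infty]$ be its nonnegative square root. Let $X$ be a real-valued random variable having a log-concave density with respect to Lebesgue measure, that is, a density $f:\mathbb R\to[0,\infty)$ with $f(ax+by)\ge f(x)^a f(y)^b$ for all $x,y\in\mathbb R$ and all $a,b>0$ with $a+b=1$. Then $$\mathcal V(X+Y)\ \ge\ \mathcal V(X)$$ for every real-valued random variable $Y$ defined on the same probability space and independent of $X$. -/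

import Mathlib

open MeasureTheory ProbabilityTheory
open scoped ENNReal

noncomputable section

/-- The distance variance `𝒱²(X) ∈ [0, ∞]` of a real random variable `X` on `(Ω, P)`:
`(1 / c₁²) ∬ |φ(s + t) - φ(s) φ(t)|² / (|s|² |t|²) ds dt`, where `φ(s) = E[exp(i s X)]` is the
characteristic function of `X` and `c₁ = π^((1+1)/2) / Γ((1+1)/2) = π`.
The integral of this nonnegative function is a Lebesgue integral with values in `[0, ∞]`, so that
no integrability of `X` is needed. -/
def distanceVariance {Ω : Type*} [MeasurableSpace Ω] (X : Ω → ℝ) (P : Measure Ω) : ℝ≥0∞ :=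
  ENNReal.ofReal (1 / Real.pi ^ 2) *
    ∫⁻ p : ℝ × ℝ, ENNReal.ofReal
      (‖charFun (P.map X) (p.1 + p.2) - charFun (P.map X) p.1 * charFun (P.map X) p.2‖ ^ 2 /
        (|p.1| ^ 2 * |p.2| ^ 2))

/-- The distance standard deviation `𝒱(X) ∈ [0, ∞]`, the nonnegative square root of `𝒱²(X)`. -/
def distanceStd {Ω : Type*} [MeasurableSpace Ω] (X : Ω → ℝ) (P : Measure Ω) : ℝ≥0∞ :=
  distanceVariance X P ^ (1 / 2 : ℝ)

/-- A function `f : ℝ → [0, ∞)` is log-concave if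
`f (a x + b y) ≥ f(x)^a f(y)^b` for all `x, y` and all `a, b > 0` with `a + b = 1`. The function
may vanish: `0 ^ a = 0` for `a > 0`. -/
def IsLogConcave (f : ℝ → ℝ) : Prop :=
  (∀ x, 0 ≤ f x) ∧
    ∀ x y a b : ℝ, 0 < a → 0 < b → a + b = 1 → f x ^ a * f y ^ b ≤ f (a * x + b * y)

/-- `X` has a log-concave density with respect to Lebesgue measure. -/
def HasLogConcaveDensity {Ω : Type*} [MeasurableSpace Ω] (X : Ω → ℝ) (P : Measure Ω) : Prop :=
  ∃ f : ℝ → ℝ, Measurable f ∧ IsLogConcave f ∧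
    P.map X = (volume : Measure ℝ).withDensity (fun x => ENNReal.ofReal (f x))

end

/-! With X' an independent copy of X, 2(φ(s+t) - φ(s)φ(t)) is the expectation of (e^{isX} -
e^{isX'})(e^{itX} - e^{itX'}). Up to phase and scaling, (e^{isa} - e^{isb})/s is the Fourier
transform of a difference of Heaviside functions jumping at a and b. Plancherel in each variable
then expresses the distance variance through the distribution function F: 𝒱² = ∬ (2(min(F x, F y) -
F x F y))² dx dy. This holds when the second moment is finite (`distanceVariance_eq_lintegral`), in
particular for log-concave X. X + Y may lack moments, but there only "≥" is needed, and it follows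
from an exponential regularization and Fatou (`lintegral_le_distanceVariance`).

It remains to compare F with the distribution function G of X + Y. Log-concavity makes F(x + δ) a
concave function of F(x). Averaging its tangent line over Y shows that F a = G u implies G(u + δ) ≤
F(a + δ) (`cdf_conv_add_le`): quantiles of X + Y are at least as spread out as those of X. Hence F⁻¹
∘ G is 1-Lipschitz, and ∫ φ(F) ≤ ∫ φ(G) for every φ ≥ 0 vanishing at 0 and 1
(`lintegral_comp_le_of_dispersive`). The integrand above has this property in each variable. -/

/-! ### Plancherel's theorem, for functions and for mixtures of products -/

section Plancherel

open scoped FourierTransform SchwartzMap ContDiff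

/-- The `L²` Fourier transform of a function in `L¹ ∩ L²` is its Fourier integral. -/
lemma fourier_toLp_ae_eq {f : ℝ → ℂ} (hf : Integrable f) (hf2 : MemLp f 2) :
    ((𝓕 (hf2.toLp f) : Lp ℂ 2 (volume : Measure ℝ)) : ℝ → ℂ) =ᵐ[volume] 𝓕 f := by
  have hcont : Continuous (𝓕 f) :=
    VectorFourier.fourierIntegral_continuous Real.continuous_fourierChar
      (by fun_prop) hf
  apply ae_eq_of_integral_contDiff_smul_eq
  · exact (Lp.memLp _).locallyIntegrable (by norm_num)
  · exact hcont.locallyIntegrable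
  intro g hg hgs
  have hgs' : HasCompactSupport (fun x => (g x : ℂ)) := by
    exact hgs.comp_left (g := fun x : ℝ => (x : ℂ)) (by simp)
  have hg' : ContDiff ℝ ∞ (fun x => (g x : ℂ)) := Complex.ofRealCLM.contDiff.comp hg
  let φ : 𝓢(ℝ, ℂ) := hgs'.toSchwartzMap hg'
  have hφ : ∀ x, φ x = (g x : ℂ) := fun x => rfl
  -- Both transforms are tested against φ, and in both the transform moves onto φ: for the L² one
  -- through tempered distributions, for the integral one by Fubini.
  have h1 := congrArg (fun T => T φ) (Lp.fourier_toTemperedDistribution_eq (hf2.toLp f))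
  simp only [TemperedDistribution.fourier_apply, Lp.toTemperedDistribution_apply] at h1
  have h2 : ∫ x, (𝓕 φ) x • (hf2.toLp f) x = ∫ x, (𝓕 φ) x • f x := by
    apply integral_congr_ae
    filter_upwards [hf2.coeFn_toLp] with x hx
    rw [hx]
  have h3 : ∫ x, (𝓕 f x) • φ x = ∫ x, f x • (𝓕 (φ : ℝ → ℂ)) x := by
    have := VectorFourier.integral_fourierIntegral_smul_eq_flip (L := innerₗ ℝ) (ν := volume)
      Real.continuous_fourierChar (by fun_prop) hf (φ.integrable (μ := volume))
    rwa [flip_innerₗ] at this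
  have h4 : ∀ x, (𝓕 φ) x = 𝓕 (φ : ℝ → ℂ) x := fun x => by rw [SchwartzMap.fourier_coe]
  calc ∫ x, g x • (𝓕 (hf2.toLp f) : Lp ℂ 2 (volume : Measure ℝ)) x
      = ∫ x, φ x • (𝓕 (hf2.toLp f) : Lp ℂ 2 (volume : Measure ℝ)) x := by
        simp [hφ]
    _ = ∫ x, (𝓕 f x) • φ x := by
        rw [← h1, h2, h3]
        simp [h4, mul_comm]
    _ = ∫ x, g x • 𝓕 f x := by simp [hφ, mul_comm]

/-- Plancherel's theorem for functions in `L¹ ∩ L²`. -/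
theorem lintegral_enorm_sq_fourier {f : ℝ → ℂ} (hf : Integrable f) (hf2 : MemLp f 2) :
    ∫⁻ ξ, ‖𝓕 f ξ‖ₑ ^ 2 = ∫⁻ x, ‖f x‖ₑ ^ 2 := by
  have key : ∀ h : ℝ → ℂ, ∫⁻ x, ‖h x‖ₑ ^ 2 = eLpNorm h 2 volume ^ 2 := by
    intro h
    have := eLpNorm_nnreal_pow_eq_lintegral (f := h) (μ := volume) (p := 2) (by norm_num)
    simpa using this.symm
  rw [key, key, ← eLpNorm_congr_ae (fourier_toLp_ae_eq hf hf2),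
    ← eLpNorm_congr_ae hf2.coeFn_toLp, ← Lp.enorm_def, ← Lp.enorm_def]
  congr 1
  rw [← ofReal_norm, ← ofReal_norm, Lp.norm_fourier_eq]

lemma lintegral_enorm_sq_fourier_of_bounded {f : ℝ → ℂ} (hf : Integrable f) {C : ℝ}
    (hC : ∀ x, ‖f x‖ ≤ C) : ∫⁻ ξ, ‖𝓕 f ξ‖ₑ ^ 2 = ∫⁻ x, ‖f x‖ₑ ^ 2 := by
  refine lintegral_enorm_sq_fourier hf ?_
  rw [memLp_two_iff_integrable_sq_norm hf.1]
  refine (hf.norm.const_mul C).mono' (hf.1.norm.pow 2) (.of_forall fun x => ?_)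
  rw [Real.norm_eq_abs, abs_of_nonneg (by positivity), sq]
  exact mul_le_mul_of_nonneg_right (hC x) (norm_nonneg _)

variable {Ω' : Type*} [MeasurableSpace Ω'] {ν : Measure Ω'}

/-- Fubini moves the Fourier transform outside the mixture over p, so that scalar Plancherel applies
to the mixed function. -/
lemma lintegral_enorm_sq_integral_fourier_mul [IsFiniteMeasure ν] {D : ℝ → Ω' → ℂ} {w : Ω' → ℂ}
    (hint : Integrable (fun z : ℝ × Ω' => D z.1 z.2 * w z.2) (volume.prod ν)) {C : ℝ}
    (hC : ∀ x, ‖∫ p, D x p * w p ∂ν‖ ≤ C) :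
    ∫⁻ ξ, ‖∫ p, 𝓕 (fun x => D x p) ξ * w p ∂ν‖ₑ ^ 2
      = ∫⁻ x, ‖∫ p, D x p * w p ∂ν‖ₑ ^ 2 := by
  rw [← lintegral_enorm_sq_fourier_of_bounded hint.integral_prod_left hC]
  congr 1 with ξ
  congr 2
  have hm : AEStronglyMeasurable
      (fun z : ℝ × Ω' => Complex.exp (↑(-2 * Real.pi * inner ℝ z.1 ξ) * Complex.I))
      (volume.prod ν) := by
    apply Measurable.aestronglyMeasurable
    simp only [RCLike.inner_apply, conj_trivial]
    fun_prop
  have hint' : Integrable (fun z : ℝ × Ω' =>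
      Complex.exp (↑(-2 * Real.pi * inner ℝ z.1 ξ) * Complex.I) * (D z.1 z.2 * w z.2))
      (volume.prod ν) := by
    refine Integrable.bdd_mul (c := 1) hint hm (.of_forall fun z => ?_)
    rw [Complex.norm_exp]
    simp
  simp only [Real.fourier_eq', smul_eq_mul]
  calc ∫ p, (∫ x, Complex.exp (↑(-2 * Real.pi * inner ℝ x ξ) * Complex.I) * D x p) * w p ∂ν
      = ∫ p, (∫ x, Complex.exp (↑(-2 * Real.pi * inner ℝ x ξ) * Complex.I) * (D x p * w p)) ∂ν := by
        simp only [← integral_mul_const, mul_assoc]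
    _ = ∫ x, ∫ p, Complex.exp (↑(-2 * Real.pi * inner ℝ x ξ) * Complex.I) * (D x p * w p) ∂ν :=
        (integral_integral_swap hint').symm
    _ = _ := by simp only [integral_const_mul]

lemma stronglyMeasurable_fourier_param {D : ℝ → Ω' → ℂ}
    (hD : Measurable (Function.uncurry D)) :
    StronglyMeasurable (fun z : ℝ × Ω' => 𝓕 (fun x => D x z.2) z.1) := by
  simp only [Real.fourier_eq', smul_eq_mul]
  apply StronglyMeasurable.integral_prod_right
  apply Measurable.stronglyMeasurable
  apply Measurable.mul
  · simp only [RCLike.inner_apply, conj_trivial]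
    fun_prop
  · exact hD.comp (by fun_prop : Measurable fun z : (ℝ × Ω') × ℝ => (z.2, z.1.2))

lemma integrable_prod_mul_of_integral_norm_le [IsFiniteMeasure ν] {D : ℝ → Ω' → ℂ}
    (hD : Measurable (Function.uncurry D)) (hint : ∀ p, Integrable (fun x => D x p))
    {N : Ω' → ℝ} (hN : ∀ p, ∫ x, ‖D x p‖ ≤ N p) {w : Ω' → ℂ} (hw : Measurable w)
    (hwN : Integrable (fun p => N p * ‖w p‖) ν) :
    Integrable (fun z : ℝ × Ω' => D z.1 z.2 * w z.2) (volume.prod ν) := by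
  have hm : Measurable (fun z : ℝ × Ω' => D z.1 z.2 * w z.2) := hD.mul (hw.comp measurable_snd)
  rw [integrable_prod_iff' hm.aestronglyMeasurable]
  refine ⟨.of_forall fun p => (hint p).mul_const (w p), ?_⟩
  refine hwN.mono' ?_ (.of_forall fun p => ?_)
  · exact (hm.norm.stronglyMeasurable.integral_prod_left').aestronglyMeasurable
  · rw [Real.norm_eq_abs, abs_of_nonneg (integral_nonneg fun x => norm_nonneg _)]
    simp only [norm_mul, integral_mul_const]
    exact mul_le_mul_of_nonneg_right (hN p) (norm_nonneg _)

lemma norm_integral_mul_le_of_norm_le_one {D w : Ω' → ℂ} (hD : ∀ p, ‖D p‖ ≤ 1) {B : Ω' → ℝ}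
    (hB : Integrable B ν) (hw : ∀ p, ‖w p‖ ≤ B p) :
    ‖∫ p, D p * w p ∂ν‖ ≤ ∫ p, B p ∂ν := by
  refine norm_integral_le_of_norm_le hB (.of_forall fun p => ?_)
  rw [norm_mul]
  exact (mul_le_of_le_one_left (norm_nonneg _) (hD p)).trans (hw p)

/-- Plancherel's theorem, applied in each of the two variables, for a mixture of products. -/
theorem lintegral_enorm_sq_integral_fourier_mul_fourier [IsFiniteMeasure ν] {D : ℝ → Ω' → ℂ}
    (hD : Measurable (Function.uncurry D)) (hb : ∀ x p, ‖D x p‖ ≤ 1)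
    (hint : ∀ p, Integrable (fun x => D x p)) {N : Ω' → ℝ}
    (hN : ∀ p, ∫ x, ‖D x p‖ ≤ N p) (hN2 : MemLp N 2 ν) :
    ∫⁻ η, ∫⁻ ξ, ‖∫ p, 𝓕 (fun x => D x p) ξ * 𝓕 (fun x => D x p) η ∂ν‖ₑ ^ 2
      = ∫⁻ x, ∫⁻ y, ‖∫ p, D y p * D x p ∂ν‖ₑ ^ 2 := by
  have hN0 : ∀ p, 0 ≤ N p := fun p => (integral_nonneg fun x => norm_nonneg _).trans (hN p)
  have hNi : Integrable N ν := hN2.integrable (by norm_num)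
  have hFm := stronglyMeasurable_fourier_param hD
  have hFN : ∀ ξ p, ‖𝓕 (fun x => D x p) ξ‖ ≤ N p := fun ξ p =>
    (VectorFourier.norm_fourierIntegral_le_integral_norm _ _ _ _ _).trans (hN p)
  generalize hF : (fun ξ p => 𝓕 (fun x => D x p) ξ) = F at *
  have hF' : ∀ ξ p, 𝓕 (fun x => D x p) ξ = F ξ p := fun ξ p => congrFun (congrFun hF ξ) p
  simp only [hF'] at hFm hFN ⊢
  have hFm' : ∀ η, Measurable fun p => F η p := fun η =>
    hFm.measurable.comp (by fun_prop : Measurable fun p : Ω' => (η, p))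
  have hDm' : ∀ x, Measurable fun p => D x p := fun x =>
    hD.comp (by fun_prop : Measurable fun p : Ω' => (x, p))
  have step : ∀ {w : Ω' → ℂ} {C : ℝ},
      Integrable (fun z : ℝ × Ω' => D z.1 z.2 * w z.2) (volume.prod ν) →
      (∀ x, ‖∫ p, D x p * w p ∂ν‖ ≤ C) →
      ∫⁻ ξ, ‖∫ p, F ξ p * w p ∂ν‖ₑ ^ 2 = ∫⁻ x, ‖∫ p, D x p * w p ∂ν‖ₑ ^ 2 := by
    intro w C h1 h2
    simpa only [hF'] using lintegral_enorm_sq_integral_fourier_mul h1 h2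
  have e1 : ∀ η, ∫⁻ ξ, ‖∫ p, F ξ p * F η p ∂ν‖ₑ ^ 2
      = ∫⁻ x, ‖∫ p, D x p * F η p ∂ν‖ₑ ^ 2 := by
    intro η
    refine step (integrable_prod_mul_of_integral_norm_le hD hint hN (hFm' η) ?_)
      (fun x => norm_integral_mul_le_of_norm_le_one (hb x) hNi (hFN η))
    -- The weight `F η` is itself only bounded by N, so the dominating function is N²; this is where
    -- N ∈ L² is needed.
    refine hN2.integrable_sq.mono' (hN2.1.mul (hFm' η).norm.aestronglyMeasurable)
      (.of_forall fun p => ?_)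
    rw [norm_mul, norm_norm, Real.norm_of_nonneg (hN0 p), sq]
    exact mul_le_mul_of_nonneg_left (hFN η p) (hN0 p)
  have e2 : ∀ x, ∫⁻ η, ‖∫ p, F η p * D x p ∂ν‖ₑ ^ 2
      = ∫⁻ y, ‖∫ p, D y p * D x p ∂ν‖ₑ ^ 2 := by
    intro x
    refine step (integrable_prod_mul_of_integral_norm_le hD hint hN (hDm' x) ?_)
      (fun y => norm_integral_mul_le_of_norm_le_one (hb y) (integrable_const (1 : ℝ)) (hb x))
    refine hNi.mono' (hNi.1.mul (hDm' x).norm.aestronglyMeasurable) (.of_forall fun p => ?_)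
    rw [norm_mul, norm_norm, Real.norm_of_nonneg (hN0 p)]
    exact mul_le_of_le_one_right (hN0 p) (hb x p)
  -- Plancherel in ξ has been applied for each fixed η; Tonelli then fixes x, and Plancherel applies
  -- in η.
  simp only [e1]
  rw [lintegral_lintegral_swap]
  · refine lintegral_congr fun x => ?_
    rw [← e2 x]
    simp only [mul_comm]
  · refine AEMeasurable.pow_const (Measurable.aemeasurable (Measurable.enorm ?_)) 2
    apply StronglyMeasurable.measurable
    apply StronglyMeasurable.integral_prod_right
    apply Measurable.stronglyMeasurable
    exact (hD.comp (by fun_prop : Measurable fun z : (ℝ × ℝ) × Ω' => (z.1.2, z.2))).mul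
      (hFm.measurable.comp (by fun_prop : Measurable fun z : (ℝ × ℝ) × Ω' => (z.1.1, z.2)))

end Plancherel

/-! ### Exponential and Heaviside kernels and their Fourier transforms -/

section Kernel

open scoped FourierTransform

/-- The one-sided exponential kernel; for `ε = 0` the Heaviside function. -/
noncomputable def expKernel (ε u : ℝ) : ℝ := if 0 ≤ u then Real.exp (-ε * u) else 0

lemma measurable_expKernel (ε : ℝ) : Measurable (expKernel ε) :=
  Measurable.ite measurableSet_Ici (by fun_prop) measurable_const

lemma expKernel_nonneg (ε u : ℝ) : 0 ≤ expKernel ε u := by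
  unfold expKernel
  split_ifs <;> positivity

lemma expKernel_le_one {ε : ℝ} (hε : 0 ≤ ε) (u : ℝ) : expKernel ε u ≤ 1 := by
  unfold expKernel
  split_ifs with h
  · rw [Real.exp_le_one_iff]
    nlinarith
  · exact zero_le_one

lemma expKernel_zero_left (u : ℝ) : expKernel 0 u = if 0 ≤ u then 1 else 0 := by
  simp [expKernel]

lemma tendsto_expKernel (u : ℝ) :
    Filter.Tendsto (fun n : ℕ => expKernel (1 / ((n : ℝ) + 1)) u) Filter.atTop
      (nhds (expKernel 0 u)) := by
  unfold expKernel
  split_ifs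
  · have h : Continuous fun ε : ℝ => Real.exp (-ε * u) := by fun_prop
    exact (h.tendsto 0).comp tendsto_one_div_add_atTop_nhds_zero_nat
  · exact tendsto_const_nhds

lemma expKernel_sub_eq_indicator (ε a : ℝ) :
    (fun x : ℝ => expKernel ε (x - a)) =
      (Set.Ici a).indicator (fun x => Real.exp (ε * a) * Real.exp (-ε * x)) := by
  ext x
  by_cases h : a ≤ x
  · rw [Set.indicator_of_mem (by exact h), expKernel, if_pos (by linarith), ← Real.exp_add]
    ring_nf
  · rw [Set.indicator_of_notMem (by exact h), expKernel, if_neg (by linarith)]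

lemma integrable_expKernel_sub {ε : ℝ} (hε : 0 < ε) (a : ℝ) :
    Integrable (fun x : ℝ => expKernel ε (x - a)) := by
  rw [expKernel_sub_eq_indicator, integrable_indicator_iff measurableSet_Ici,
    integrableOn_Ici_iff_integrableOn_Ioi]
  exact (integrableOn_exp_mul_Ioi (by linarith) a).const_mul _

lemma integral_expKernel_sub {ε : ℝ} (hε : 0 < ε) (a : ℝ) :
    ∫ x : ℝ, expKernel ε (x - a) = 1 / ε := by
  rw [expKernel_sub_eq_indicator, integral_indicator measurableSet_Ici,
    integral_Ici_eq_integral_Ioi, integral_const_mul, integral_exp_mul_Ioi (by linarith)]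
  have : Real.exp (ε * a) * Real.exp (-ε * a) = 1 := by
    rw [← Real.exp_add]
    simp
  rw [mul_div_assoc', mul_neg, this, neg_div_neg_eq]

lemma fourier_expKernel_sub {ε : ℝ} (hε : 0 < ε) (a ξ : ℝ) :
    𝓕 (fun x : ℝ => (expKernel ε (x - a) : ℂ)) ξ =
      Complex.exp ((-2 * Real.pi * ξ : ℝ) * a * Complex.I) / (ε + 2 * Real.pi * ξ * Complex.I) := by
  have hre : (-(ε + 2 * Real.pi * ξ * Complex.I : ℂ)).re < 0 := by simp [hε]
  have hne : (ε + 2 * Real.pi * ξ * Complex.I : ℂ) ≠ 0 := by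
    intro h
    simp [h] at hre
  have h1 : ∀ x : ℝ, Complex.exp (↑(-2 * Real.pi * inner ℝ x ξ) * Complex.I) *
      (expKernel ε (x - a) : ℂ) = (Set.Ici a).indicator (fun x : ℝ => Complex.exp (ε * a) *
        Complex.exp (-(ε + 2 * Real.pi * ξ * Complex.I) * x)) x := by
    intro x
    by_cases h : a ≤ x
    · rw [Set.indicator_of_mem (by exact h), expKernel, if_pos (by linarith), Complex.ofReal_exp,
        ← Complex.exp_add, ← Complex.exp_add]
      congr 1
      simp
      ring
    · rw [Set.indicator_of_notMem (by exact h), expKernel, if_neg (by linarith)]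
      simp
  simp only [Real.fourier_eq', smul_eq_mul, h1]
  rw [integral_indicator measurableSet_Ici,
    integral_Ici_eq_integral_Ioi, integral_const_mul, integral_exp_mul_complex_Ioi hre, neg_div_neg_eq,
    ← mul_div_assoc, ← Complex.exp_add]
  congr 2
  push_cast
  ring

/-- The difference of two translates of the one-sided exponential kernel. -/
noncomputable def kernelDiff (ε x : ℝ) (p : ℝ × ℝ) : ℂ :=
  (expKernel ε (x - p.1) : ℂ) - (expKernel ε (x - p.2) : ℂ)

lemma measurable_kernelDiff (ε : ℝ) : Measurable (Function.uncurry (kernelDiff ε)) := by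
  have := measurable_expKernel ε
  unfold kernelDiff Function.uncurry
  fun_prop

lemma norm_kernelDiff_le_one {ε : ℝ} (hε : 0 ≤ ε) (x : ℝ) (p : ℝ × ℝ) :
    ‖kernelDiff ε x p‖ ≤ 1 := by
  unfold kernelDiff
  rw [← Complex.ofReal_sub, Complex.norm_real, Real.norm_eq_abs, abs_le]
  have := expKernel_nonneg ε (x - p.1)
  have := expKernel_nonneg ε (x - p.2)
  have := expKernel_le_one hε (x - p.1)
  have := expKernel_le_one hε (x - p.2)
  constructor <;> linarith

lemma integrable_kernelDiff_of_pos {ε : ℝ} (hε : 0 < ε) (p : ℝ × ℝ) :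
    Integrable (fun x => kernelDiff ε x p) :=
  (integrable_expKernel_sub hε p.1).ofReal.sub (integrable_expKernel_sub hε p.2).ofReal

lemma integral_norm_kernelDiff_of_pos {ε : ℝ} (hε : 0 < ε) (p : ℝ × ℝ) :
    ∫ x, ‖kernelDiff ε x p‖ ≤ 2 / ε := by
  calc ∫ x, ‖kernelDiff ε x p‖ ≤ ∫ x, (expKernel ε (x - p.1) + expKernel ε (x - p.2)) := by
        refine integral_mono (integrable_kernelDiff_of_pos hε p).norm
          ((integrable_expKernel_sub hε p.1).add (integrable_expKernel_sub hε p.2)) fun x => ?_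
        refine (norm_sub_le _ _).trans (le_of_eq ?_)
        simp [abs_of_nonneg, expKernel_nonneg]
    _ = 2 / ε := by
        rw [integral_add (integrable_expKernel_sub hε p.1) (integrable_expKernel_sub hε p.2),
          integral_expKernel_sub hε, integral_expKernel_sub hε]
        ring

lemma fourier_kernelDiff_of_pos {ε : ℝ} (hε : 0 < ε) (p : ℝ × ℝ) (ξ : ℝ) :
    𝓕 (fun x => kernelDiff ε x p) ξ =
      (Complex.exp ((-2 * Real.pi * ξ : ℝ) * p.1 * Complex.I) -
        Complex.exp ((-2 * Real.pi * ξ : ℝ) * p.2 * Complex.I)) /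
          (ε + 2 * Real.pi * ξ * Complex.I) := by
  rw [sub_div, ← fourier_expKernel_sub hε, ← fourier_expKernel_sub hε]
  unfold kernelDiff
  simp only [Real.fourier_eq', smul_eq_mul, mul_sub]
  have key : ∀ a : ℝ, Integrable fun x : ℝ =>
      Complex.exp (↑(-2 * Real.pi * inner ℝ x ξ) * Complex.I) * (expKernel ε (x - a) : ℂ) := by
    intro a
    refine (integrable_expKernel_sub hε a).ofReal.bdd_mul (c := 1) ?_ (.of_forall fun z => ?_)
    · exact Continuous.aestronglyMeasurable (by fun_prop)
    · rw [Complex.norm_exp]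
      simp
  exact integral_sub (key _) (key _)

lemma kernelDiff_swap (ε x : ℝ) (p : ℝ × ℝ) : kernelDiff ε x p.swap = -kernelDiff ε x p := by
  simp [kernelDiff]

/-- A single Heaviside function is not integrable, but the difference of two translates is. Pairs in
the opposite order reduce to this case by `kernelDiff_swap`. -/
lemma kernelDiff_zero_of_le {p : ℝ × ℝ} (hp : p.1 ≤ p.2) :
    (fun x => kernelDiff 0 x p) = (Set.Ico p.1 p.2).indicator fun _ => 1 := by
  ext x
  simp only [kernelDiff, expKernel_zero_left, Set.indicator, Set.mem_Ico, sub_nonneg]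
  by_cases h1 : p.1 ≤ x <;> by_cases h2 : p.2 ≤ x <;> simp [h1, h2]
  exact h1 (hp.trans h2)

lemma integrable_kernelDiff_zero (p : ℝ × ℝ) : Integrable (fun x => kernelDiff 0 x p) := by
  have key : ∀ p : ℝ × ℝ, p.1 ≤ p.2 → Integrable (fun x => kernelDiff 0 x p) := by
    intro p hp
    rw [kernelDiff_zero_of_le hp, integrable_indicator_iff measurableSet_Ico]
    exact integrableOn_const (by simp)
  rcases le_total p.1 p.2 with hp | hp
  · exact key p hp
  · simpa [kernelDiff_swap] using (key p.swap hp).neg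

lemma integral_norm_kernelDiff_zero (p : ℝ × ℝ) : ∫ x, ‖kernelDiff 0 x p‖ = |p.1 - p.2| := by
  have key : ∀ p : ℝ × ℝ, p.1 ≤ p.2 → ∫ x, ‖kernelDiff 0 x p‖ = |p.1 - p.2| := by
    intro p hp
    have : ∀ x, ‖kernelDiff 0 x p‖ = (Set.Ico p.1 p.2).indicator (fun _ => (1 : ℝ)) x := by
      intro x
      rw [congrFun (kernelDiff_zero_of_le hp) x, norm_indicator_eq_indicator_norm]
      simp
    simp only [this]
    rw [integral_indicator measurableSet_Ico, abs_sub_comm, abs_of_nonneg (by linarith)]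
    simp [hp]
  rcases le_total p.1 p.2 with hp | hp
  · exact key p hp
  · simpa [kernelDiff_swap, abs_sub_comm] using key p.swap hp

lemma fourier_kernelDiff_zero (p : ℝ × ℝ) {ξ : ℝ} (hξ : ξ ≠ 0) :
    𝓕 (fun x => kernelDiff 0 x p) ξ =
      (Complex.exp ((-2 * Real.pi * ξ : ℝ) * p.1 * Complex.I) -
        Complex.exp ((-2 * Real.pi * ξ : ℝ) * p.2 * Complex.I)) /
          ((0 : ℝ) + 2 * Real.pi * ξ * Complex.I) := by
  have key : ∀ p : ℝ × ℝ, p.1 ≤ p.2 → 𝓕 (fun x => kernelDiff 0 x p) ξ =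
      (Complex.exp ((-2 * Real.pi * ξ : ℝ) * p.1 * Complex.I) -
        Complex.exp ((-2 * Real.pi * ξ : ℝ) * p.2 * Complex.I)) /
          ((0 : ℝ) + 2 * Real.pi * ξ * Complex.I) := by
    intro p hp
    have h1 : ∀ x : ℝ, Complex.exp (↑(-2 * Real.pi * inner ℝ x ξ) * Complex.I) *
        kernelDiff 0 x p = (Set.Ico p.1 p.2).indicator (fun x : ℝ =>
          Complex.exp ((-(2 * Real.pi * ξ * Complex.I)) * x)) x := by
      intro x
      rw [congrFun (kernelDiff_zero_of_le hp) x]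
      by_cases h : x ∈ Set.Ico p.1 p.2
      · rw [Set.indicator_of_mem h, Set.indicator_of_mem h, mul_one]
        congr 1
        simp
        ring
      · rw [Set.indicator_of_notMem h, Set.indicator_of_notMem h, mul_zero]
    have hne : (2 * Real.pi * ξ * Complex.I : ℂ) ≠ 0 := by
      simp [hξ, Real.pi_ne_zero]
    simp only [Real.fourier_eq', smul_eq_mul, h1]
    rw [integral_indicator measurableSet_Ico, integral_Ico_eq_integral_Ioc,
      ← intervalIntegral.integral_of_le hp, integral_exp_mul_complex (neg_ne_zero.2 hne),
      div_neg, ← neg_div, neg_sub]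
    simp only [Complex.ofReal_zero, zero_add]
    congr 3 <;> push_cast <;> ring
  rcases le_total p.1 p.2 with hp | hp
  · exact key p hp
  · have h2 := key p.swap hp
    have h3 : 𝓕 (fun x => kernelDiff 0 x p.swap) ξ = -𝓕 (fun x => kernelDiff 0 x p) ξ := by
      simp only [Real.fourier_eq', smul_eq_mul, kernelDiff_swap, mul_neg, integral_neg]
    rw [h3] at h2
    rw [← neg_inj, h2, ← neg_div, neg_sub]
    rfl

end Kernel

/-! ### Covariances as mixtures, and Plancherel for the regularized distance variance -/

section Covariance

open scoped FourierTransform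

/-- The independent-copy formula for the covariance; it is used both for exponentials and for
kernels. -/
lemma integral_prod_sub_mul_sub {μ : Measure ℝ} [IsProbabilityMeasure μ] {u v : ℝ → ℂ}
    (hu : MemLp u 2 μ) (hv : MemLp v 2 μ) :
    ∫ p : ℝ × ℝ, (u p.1 - u p.2) * (v p.1 - v p.2) ∂(μ.prod μ) =
      2 * (∫ a, u a * v a ∂μ - (∫ a, u a ∂μ) * ∫ a, v a ∂μ) := by
  have hui : Integrable u μ := hu.integrable (by norm_num)
  have hvi : Integrable v μ := hv.integrable (by norm_num)
  have huv : Integrable (fun a => u a * v a) μ := hu.integrable_mul hv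
  have i1 : Integrable (fun p : ℝ × ℝ => u p.1 * v p.1) (μ.prod μ) := huv.comp_fst μ
  have i2 : Integrable (fun p : ℝ × ℝ => u p.2 * v p.2) (μ.prod μ) := huv.comp_snd μ
  have i3 : Integrable (fun p : ℝ × ℝ => u p.1 * v p.2) (μ.prod μ) := hui.mul_prod hvi
  have i4 : Integrable (fun p : ℝ × ℝ => v p.1 * u p.2) (μ.prod μ) := hvi.mul_prod hui
  have e : ∀ p : ℝ × ℝ, (u p.1 - u p.2) * (v p.1 - v p.2) =
      (u p.1 * v p.1 + u p.2 * v p.2) - (u p.1 * v p.2 + v p.1 * u p.2) := fun p => by ring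
  simp only [e]
  have i12 : Integrable (fun p : ℝ × ℝ => u p.1 * v p.1 + u p.2 * v p.2) (μ.prod μ) := i1.add i2
  have i34 : Integrable (fun p : ℝ × ℝ => u p.1 * v p.2 + v p.1 * u p.2) (μ.prod μ) := i3.add i4
  rw [integral_sub i12 i34, integral_add i1 i2, integral_add i3 i4,
    integral_prod_mul, integral_prod_mul, integral_fun_fst (fun a => u a * v a),
    integral_fun_snd (fun a => u a * v a)]
  simp
  ring

/-- The numerator `φ(s + t) - φ(s) φ(t)` in the distance variance. -/
noncomputable def charFunCov (μ : Measure ℝ) (s t : ℝ) : ℂ :=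
  charFun μ (s + t) - charFun μ s * charFun μ t

lemma measurable_charFunCov (μ : Measure ℝ) [SFinite μ] :
    Measurable (fun p : ℝ × ℝ => charFunCov μ p.1 p.2) := by
  have : Measurable (charFun μ) := measurable_charFun
  unfold charFunCov
  fun_prop

/-- Twice the covariance of two translates of the exponential kernel. -/
noncomputable def kernelCov (μ : Measure ℝ) (ε x y : ℝ) : ℝ :=
  2 * (∫ a, expKernel ε (x - a) * expKernel ε (y - a) ∂μ -
    (∫ a, expKernel ε (x - a) ∂μ) * ∫ a, expKernel ε (y - a) ∂μ)

lemma measurable_kernelCov (μ : Measure ℝ) [SFinite μ] (ε : ℝ) :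
    Measurable (fun p : ℝ × ℝ => kernelCov μ ε p.1 p.2) := by
  have hk := measurable_expKernel ε
  have h1 : Measurable fun p : ℝ × ℝ => ∫ a, expKernel ε (p.1 - a) * expKernel ε (p.2 - a) ∂μ :=
    (StronglyMeasurable.integral_prod_right
      (f := fun (p : ℝ × ℝ) a => expKernel ε (p.1 - a) * expKernel ε (p.2 - a))
      (Measurable.stronglyMeasurable (by unfold Function.uncurry; fun_prop))).measurable
  have h2 : Measurable fun x : ℝ => ∫ a, expKernel ε (x - a) ∂μ :=
    (StronglyMeasurable.integral_prod_right (f := fun x a => expKernel ε (x - a))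
      (Measurable.stronglyMeasurable (by unfold Function.uncurry; fun_prop))).measurable
  exact (h1.sub ((h2.comp measurable_fst).mul (h2.comp measurable_snd))).const_mul 2

variable {μ : Measure ℝ} [IsProbabilityMeasure μ]

lemma integral_kernelDiff_mul {ε : ℝ} (hε : 0 ≤ ε) (x y : ℝ) :
    ∫ p, kernelDiff ε y p * kernelDiff ε x p ∂(μ.prod μ) = (kernelCov μ ε x y : ℂ) := by
  have hm : ∀ z : ℝ, MemLp (fun a => (expKernel ε (z - a) : ℂ)) 2 μ := by
    intro z
    have := measurable_expKernel ε
    refine MemLp.of_bound (Measurable.aestronglyMeasurable (by fun_prop)) 1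
      (.of_forall fun a => ?_)
    rw [Complex.norm_real, Real.norm_of_nonneg (expKernel_nonneg _ _)]
    exact expKernel_le_one hε _
  unfold kernelDiff
  rw [integral_prod_sub_mul_sub (hm y) (hm x)]
  unfold kernelCov
  simp only [← Complex.ofReal_mul, integral_complex_ofReal]
  push_cast
  simp only [mul_comm]

lemma integral_exp_sub_mul_exp_sub (s t : ℝ) :
    ∫ p : ℝ × ℝ, (Complex.exp (s * p.1 * Complex.I) - Complex.exp (s * p.2 * Complex.I)) *
      (Complex.exp (t * p.1 * Complex.I) - Complex.exp (t * p.2 * Complex.I)) ∂(μ.prod μ) =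
      2 * charFunCov μ s t := by
  have hm : ∀ s : ℝ, MemLp (fun a : ℝ => Complex.exp (s * a * Complex.I)) 2 μ := by
    intro s
    refine MemLp.of_bound (Measurable.aestronglyMeasurable (by fun_prop)) 1
      (.of_forall fun a => ?_)
    rw [Complex.norm_exp]
    simp
  rw [integral_prod_sub_mul_sub (hm s) (hm t)]
  have e : ∀ a : ℝ, Complex.exp (s * a * Complex.I) * Complex.exp (t * a * Complex.I) =
      Complex.exp (↑(s + t) * a * Complex.I) := by
    intro a
    rw [← Complex.exp_add]
    congr 1
    push_cast
    ring
  simp only [charFunCov, charFun_apply_real, e]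

/-- The substitution s = -2πξ reconciles the exponential e^{-2πixξ} of the Fourier transform with
the e^{isx} of the characteristic function. -/
lemma lintegral_eq_mul_lintegral_comp_neg_two_pi_mul {g : ℝ → ℝ≥0∞} (hg : Measurable g) :
    ∫⁻ s, g s = ENNReal.ofReal (2 * Real.pi) * ∫⁻ ξ, g (-2 * Real.pi * ξ) := by
  have h := Real.smul_map_volume_mul_left (a := -2 * Real.pi) (by simp [Real.pi_ne_zero])
  have h2 : |-2 * Real.pi| = 2 * Real.pi := by
    rw [neg_mul, abs_neg, abs_of_pos (by positivity)]
  rw [h2] at h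
  conv_lhs => rw [← h]
  rw [lintegral_smul_measure, lintegral_map hg (by fun_prop), smul_eq_mul]

/-- The factor 4 is the square of the 2 in the independent-copy formula, and |ε + 2πiξ|² = ε² + s².
-/
lemma enorm_sq_fourier_kernel_mixture {ε s t ξ η : ℝ} (hs : s = -2 * Real.pi * ξ)
    (ht : t = -2 * Real.pi * η) :
    ‖∫ p : ℝ × ℝ, ((Complex.exp (s * p.1 * Complex.I) - Complex.exp (s * p.2 * Complex.I)) /
          (ε + 2 * Real.pi * ξ * Complex.I)) *
        ((Complex.exp (t * p.1 * Complex.I) - Complex.exp (t * p.2 * Complex.I)) /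
          (ε + 2 * Real.pi * η * Complex.I)) ∂(μ.prod μ)‖ₑ ^ 2 =
      4 * ENNReal.ofReal (‖charFunCov μ s t‖ ^ 2 / ((ε ^ 2 + s ^ 2) * (ε ^ 2 + t ^ 2))) := by
  simp only [div_mul_div_comm]
  rw [integral_div, integral_exp_sub_mul_exp_sub, ← ofReal_norm, ← ENNReal.ofReal_pow (norm_nonneg _),
    show (4 : ℝ≥0∞) = ENNReal.ofReal 4 by simp, ← ENNReal.ofReal_mul (by norm_num)]
  congr 1
  have hn : ∀ ξ : ℝ, ‖(ε + 2 * Real.pi * ξ * Complex.I : ℂ)‖ ^ 2 =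
      ε ^ 2 + (-2 * Real.pi * ξ) ^ 2 := by
    intro ξ
    rw [← Complex.normSq_eq_norm_sq, show (ε + 2 * Real.pi * ξ * Complex.I : ℂ) =
      (ε : ℂ) + ((2 * Real.pi * ξ : ℝ) : ℂ) * Complex.I by push_cast; ring, Complex.normSq_add_mul_I]
    ring
  rw [norm_div, norm_mul, norm_mul, div_pow, mul_pow, mul_pow, hn, hn, ← hs, ← ht]
  norm_num
  ring

lemma lintegral_lintegral_eq_mul_comp_neg_two_pi_mul {q : ℝ → ℝ → ℝ≥0∞}
    (hq : Measurable (Function.uncurry q)) :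
    4 * ∫⁻ t, ∫⁻ s, q s t = ENNReal.ofReal (Real.pi ^ 2) *
      (16 * ∫⁻ η, ∫⁻ ξ, q (-2 * Real.pi * ξ) (-2 * Real.pi * η)) := by
  have hq1 : ∀ t, Measurable fun s => q s t := fun t =>
    hq.comp (by fun_prop : Measurable fun s : ℝ => (s, t))
  have hq2 : Measurable fun t => ∫⁻ s, q s t :=
    (hq.comp measurable_swap).lintegral_prod_right'
  have hq3 : Measurable fun η => ∫⁻ ξ, q (-2 * Real.pi * ξ) (-2 * Real.pi * η) :=
    (hq.comp (by fun_prop : Measurable fun z : ℝ × ℝ =>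
      (-2 * Real.pi * z.2, -2 * Real.pi * z.1))).lintegral_prod_right'
  rw [lintegral_eq_mul_lintegral_comp_neg_two_pi_mul hq2]
  simp only [fun t => lintegral_eq_mul_lintegral_comp_neg_two_pi_mul (hq1 t)]
  rw [lintegral_const_mul _ hq3, ← mul_assoc, ← mul_assoc, ← mul_assoc]
  congr 1
  rw [show (4 : ℝ≥0∞) = ENNReal.ofReal 4 by simp, show (16 : ℝ≥0∞) = ENNReal.ofReal 16 by simp,
    ← ENNReal.ofReal_mul (by positivity), ← ENNReal.ofReal_mul (by positivity),
    ← ENNReal.ofReal_mul (by positivity)]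
  congr 1
  ring

/-- For ε > 0 a constant bounds the L¹ norms, whatever the law. At ε = 0 the L¹ norm is |p.1 - p.2|,
which is square-integrable when the second moment is finite. -/
lemma exists_memLp_two_bound_kernelDiff {ε : ℝ} (hε : 0 ≤ ε) (h : 0 < ε ∨ MemLp id 2 μ) :
    ∃ N : ℝ × ℝ → ℝ, (∀ p, Integrable (fun x => kernelDiff ε x p)) ∧
      (∀ p, ∫ x, ‖kernelDiff ε x p‖ ≤ N p) ∧ MemLp N 2 (μ.prod μ) := by
  rcases hε.eq_or_lt with rfl | hpos
  · have h2 : MemLp id 2 μ := h.resolve_left (lt_irrefl _)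
    refine ⟨fun p => |p.1 - p.2|, integrable_kernelDiff_zero,
      fun p => (integral_norm_kernelDiff_zero p).le, ?_⟩
    exact ((h2.comp_fst μ).sub (h2.comp_snd μ)).norm
  · exact ⟨fun _ => 2 / ε, integrable_kernelDiff_of_pos hpos,
      integral_norm_kernelDiff_of_pos hpos, memLp_const _⟩

lemma fourier_kernelDiff {ε : ℝ} (hε : 0 ≤ ε) (p : ℝ × ℝ) {ξ : ℝ} (hξ : ξ ≠ 0) :
    𝓕 (fun x => kernelDiff ε x p) ξ =
      (Complex.exp ((-2 * Real.pi * ξ : ℝ) * p.1 * Complex.I) -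
        Complex.exp ((-2 * Real.pi * ξ : ℝ) * p.2 * Complex.I)) /
          (ε + 2 * Real.pi * ξ * Complex.I) := by
  rcases hε.eq_or_lt with rfl | hpos
  · exact fourier_kernelDiff_zero p hξ
  · exact fourier_kernelDiff_of_pos hpos p ξ

lemma enorm_sq_integral_kernelDiff_mul {ε : ℝ} (hε : 0 ≤ ε) (x y : ℝ) :
    ‖∫ p, kernelDiff ε y p * kernelDiff ε x p ∂(μ.prod μ)‖ₑ ^ 2 =
      ENNReal.ofReal (kernelCov μ ε x y ^ 2) := by
  rw [integral_kernelDiff_mul hε, ← ofReal_norm, ← ENNReal.ofReal_pow (norm_nonneg _),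
    Complex.norm_real, Real.norm_eq_abs, sq_abs]

/-- The regularized integrand of the distance variance. -/
noncomputable def regIntegrand (μ : Measure ℝ) (ε s t : ℝ) : ℝ≥0∞ :=
  ENNReal.ofReal (‖charFunCov μ s t‖ ^ 2 / ((ε ^ 2 + s ^ 2) * (ε ^ 2 + t ^ 2)))

lemma measurable_regIntegrand (μ : Measure ℝ) [SFinite μ] (ε : ℝ) :
    Measurable (Function.uncurry (regIntegrand μ ε)) := by
  have := measurable_charFunCov μ
  unfold regIntegrand Function.uncurry
  fun_prop

lemma lintegral_regIntegrand_comp {ε : ℝ} (hε : 0 ≤ ε) (h : 0 < ε ∨ MemLp id 2 μ) :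
    ∫⁻ η, ∫⁻ ξ, 4 * regIntegrand μ ε (-2 * Real.pi * ξ) (-2 * Real.pi * η) =
      ∫⁻ x, ∫⁻ y, ENNReal.ofReal (kernelCov μ ε x y ^ 2) := by
  obtain ⟨N, hint, hN, hN2⟩ := exists_memLp_two_bound_kernelDiff hε h
  have hne : ∀ᵐ ξ : ℝ, ξ ≠ 0 := by simp [ae_iff]
  simp only [← enorm_sq_integral_kernelDiff_mul hε]
  rw [← lintegral_enorm_sq_integral_fourier_mul_fourier (ν := μ.prod μ)
    (measurable_kernelDiff ε) (norm_kernelDiff_le_one hε) hint hN hN2]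
  refine lintegral_congr_ae ?_
  filter_upwards [hne] with η hη
  refine lintegral_congr_ae ?_
  filter_upwards [hne] with ξ hξ
  simp only [fourier_kernelDiff hε _ hη, fourier_kernelDiff hε _ hξ]
  exact (enorm_sq_fourier_kernel_mixture rfl rfl).symm

/-- Plancherel's identity relating the regularized distance variance and the kernel covariance. -/
theorem lintegral_regIntegrand {ε : ℝ} (hε : 0 ≤ ε) (h : 0 < ε ∨ MemLp id 2 μ) :
    ∫⁻ t, ∫⁻ s, regIntegrand μ ε s t =
      ENNReal.ofReal (Real.pi ^ 2) * ∫⁻ x, ∫⁻ y, ENNReal.ofReal (kernelCov μ ε x y ^ 2) := by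
  have key := lintegral_lintegral_eq_mul_comp_neg_two_pi_mul (measurable_regIntegrand μ ε)
  rw [← lintegral_regIntegrand_comp hε h]
  rw [← ENNReal.mul_right_inj (a := 4) (by norm_num) (by norm_num), key]
  simp only [lintegral_const_mul' (4 : ℝ≥0∞) _ (by norm_num)]
  ring

end Covariance

/-! ### Distance variance in terms of the distribution function -/

section DistanceVariance

/-- Removing ε² shrinks the denominators. The axes are excluded because division by zero makes the
right side 0 there. -/
lemma regIntegrand_le_zero (μ : Measure ℝ) (ε : ℝ) {s t : ℝ} (hs : s ≠ 0) (ht : t ≠ 0) :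
    regIntegrand μ ε s t ≤ regIntegrand μ 0 s t := by
  unfold regIntegrand
  refine ENNReal.ofReal_le_ofReal ?_
  have hs2 : 0 < s ^ 2 := by positivity
  have ht2 : 0 < t ^ 2 := by positivity
  have he : (0 : ℝ) ^ 2 ≤ ε ^ 2 := by simpa using sq_nonneg ε
  generalize ε ^ 2 = e at he
  gcongr

variable {μ : Measure ℝ} [IsProbabilityMeasure μ]

lemma lintegral_distanceVariance_integrand :
    ∫⁻ p : ℝ × ℝ, ENNReal.ofReal (‖charFun μ (p.1 + p.2) - charFun μ p.1 * charFun μ p.2‖ ^ 2 /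
      (|p.1| ^ 2 * |p.2| ^ 2)) = ∫⁻ t, ∫⁻ s, regIntegrand μ 0 s t := by
  have h := lintegral_prod_symm (μ := volume) (ν := volume)
    (Function.uncurry (regIntegrand μ 0)) (measurable_regIntegrand μ 0).aemeasurable
  simp only [Function.uncurry_apply_pair] at h
  rw [← h, Measure.volume_eq_prod]
  refine lintegral_congr fun p => ?_
  simp [Function.uncurry, regIntegrand, charFunCov]

lemma tendsto_kernelCov (x y : ℝ) :
    Filter.Tendsto (fun n : ℕ => kernelCov μ (1 / ((n : ℝ) + 1)) x y) Filter.atTop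
      (nhds (kernelCov μ 0 x y)) := by
  have hm := measurable_expKernel
  have hpos : ∀ n : ℕ, 0 ≤ 1 / ((n : ℝ) + 1) := fun n => by positivity
  have h1 : ∀ x, Filter.Tendsto (fun n : ℕ => ∫ a, expKernel (1 / ((n : ℝ) + 1)) (x - a) ∂μ)
      Filter.atTop (nhds (∫ a, expKernel 0 (x - a) ∂μ)) := by
    intro x
    refine tendsto_integral_of_dominated_convergence (fun _ => (1 : ℝ))
      (fun n => Measurable.aestronglyMeasurable ((hm _).comp (by fun_prop))) (integrable_const _)
      (fun n => .of_forall fun a => ?_) (.of_forall fun a => tendsto_expKernel _)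
    rw [Real.norm_of_nonneg (expKernel_nonneg _ _)]
    exact expKernel_le_one (hpos n) _
  have h2 : Filter.Tendsto (fun n : ℕ => ∫ a, expKernel (1 / ((n : ℝ) + 1)) (x - a) *
      expKernel (1 / ((n : ℝ) + 1)) (y - a) ∂μ)
      Filter.atTop (nhds (∫ a, expKernel 0 (x - a) * expKernel 0 (y - a) ∂μ)) := by
    refine tendsto_integral_of_dominated_convergence (fun _ => (1 : ℝ))
      (fun n => Measurable.aestronglyMeasurable
        (((hm _).comp (by fun_prop)).mul ((hm _).comp (by fun_prop)))) (integrable_const _)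
      (fun n => .of_forall fun a => ?_)
      (.of_forall fun a => (tendsto_expKernel _).mul (tendsto_expKernel _))
    rw [Real.norm_of_nonneg (mul_nonneg (expKernel_nonneg _ _) (expKernel_nonneg _ _))]
    exact mul_le_one₀ (expKernel_le_one (hpos n) _) (expKernel_nonneg _ _)
      (expKernel_le_one (hpos n) _)
  exact (h2.sub ((h1 x).mul (h1 y))).const_mul 2

/-- Without a second moment the Plancherel identity is available for ε > 0 only. The regularized
integrals stay below the one at ε = 0, and Fatou along ε = 1/(n + 1) gives this inequality. -/
lemma lintegral_kernelCov_zero_sq_le :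
    ENNReal.ofReal (Real.pi ^ 2) * ∫⁻ x, ∫⁻ y, ENNReal.ofReal (kernelCov μ 0 x y ^ 2) ≤
      ∫⁻ t, ∫⁻ s, regIntegrand μ 0 s t := by
  have hm : ∀ ε, Measurable fun p : ℝ × ℝ => ENNReal.ofReal (kernelCov μ ε p.1 p.2 ^ 2) :=
    fun ε => ((measurable_kernelCov μ ε).pow_const 2).ennreal_ofReal
  have hprod : ∀ ε, ∫⁻ x, ∫⁻ y, ENNReal.ofReal (kernelCov μ ε x y ^ 2) =
      ∫⁻ p : ℝ × ℝ, ENNReal.ofReal (kernelCov μ ε p.1 p.2 ^ 2) := fun ε => by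
    rw [Measure.volume_eq_prod, lintegral_prod _ (hm ε).aemeasurable]
  have hne : ∀ᵐ s : ℝ, s ≠ 0 := by simp [ae_iff]
  have hle : ∀ n : ℕ, ENNReal.ofReal (Real.pi ^ 2) *
      ∫⁻ p : ℝ × ℝ, ENNReal.ofReal (kernelCov μ (1 / ((n : ℝ) + 1)) p.1 p.2 ^ 2) ≤
        ∫⁻ t, ∫⁻ s, regIntegrand μ 0 s t := by
    intro n
    have hpos : 0 < 1 / ((n : ℝ) + 1) := by positivity
    rw [← hprod, ← lintegral_regIntegrand hpos.le (Or.inl hpos)]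
    refine lintegral_mono_ae ?_
    filter_upwards [hne] with t ht
    refine lintegral_mono_ae ?_
    filter_upwards [hne] with s hs
    exact regIntegrand_le_zero μ _ hs ht
  have hc : ENNReal.ofReal (Real.pi ^ 2) ≠ 0 := by simp [Real.pi_ne_zero]
  rw [hprod, mul_comm, ← ENNReal.le_div_iff_mul_le (Or.inl hc) (Or.inl ENNReal.ofReal_ne_top)]
  calc ∫⁻ p : ℝ × ℝ, ENNReal.ofReal (kernelCov μ 0 p.1 p.2 ^ 2)
      = ∫⁻ p : ℝ × ℝ, Filter.liminf (fun n : ℕ =>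
          ENNReal.ofReal (kernelCov μ (1 / ((n : ℝ) + 1)) p.1 p.2 ^ 2)) Filter.atTop := by
        refine lintegral_congr fun p => ?_
        exact (ENNReal.tendsto_ofReal ((tendsto_kernelCov p.1 p.2).pow 2)).liminf_eq.symm
    _ ≤ Filter.liminf (fun n : ℕ => ∫⁻ p : ℝ × ℝ,
          ENNReal.ofReal (kernelCov μ (1 / ((n : ℝ) + 1)) p.1 p.2 ^ 2)) Filter.atTop :=
        lintegral_liminf_le fun n => hm _
    _ ≤ _ := by
        refine Filter.liminf_le_of_le (by isBoundedDefault) fun b hb => ?_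
        obtain ⟨n, hn⟩ := hb.exists
        refine hn.trans ?_
        rw [ENNReal.le_div_iff_mul_le (Or.inl hc) (Or.inl ENNReal.ofReal_ne_top), mul_comm]
        exact hle n

lemma ofReal_one_div_pi_sq_mul (a : ℝ≥0∞) :
    ENNReal.ofReal (1 / Real.pi ^ 2) * (ENNReal.ofReal (Real.pi ^ 2) * a) = a := by
  rw [← mul_assoc, ← ENNReal.ofReal_mul (by positivity),
    one_div_mul_cancel (by positivity), ENNReal.ofReal_one, one_mul]

variable {Ω : Type*} [MeasurableSpace Ω] {P : Measure Ω} [IsProbabilityMeasure P] {X : Ω → ℝ}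

/-- The distance variance of a square-integrable random variable in terms of its
distribution function. -/
theorem distanceVariance_eq_lintegral (hX : AEMeasurable X P) (h2 : MemLp id 2 (P.map X)) :
    distanceVariance X P = ∫⁻ x, ∫⁻ y, ENNReal.ofReal (kernelCov (P.map X) 0 x y ^ 2) := by
  have := Measure.isProbabilityMeasure_map hX
  rw [distanceVariance, lintegral_distanceVariance_integrand,
    lintegral_regIntegrand le_rfl (Or.inr h2), ofReal_one_div_pi_sq_mul]

theorem lintegral_le_distanceVariance (hX : AEMeasurable X P) :
    ∫⁻ x, ∫⁻ y, ENNReal.ofReal (kernelCov (P.map X) 0 x y ^ 2) ≤ distanceVariance X P := by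
  have := Measure.isProbabilityMeasure_map hX
  rw [distanceVariance, lintegral_distanceVariance_integrand,
    ← ofReal_one_div_pi_sq_mul (∫⁻ x, ∫⁻ y, ENNReal.ofReal (kernelCov (P.map X) 0 x y ^ 2))]
  gcongr
  exact lintegral_kernelCov_zero_sq_le

/-- At ε = 0 the kernel, with value 1 at 0, is the indicator of a ≤ x, and a product of two such
indicators is the one for min x y. -/
lemma kernelCov_zero (x y : ℝ) :
    kernelCov μ 0 x y = 2 * (min (cdf μ x) (cdf μ y) - cdf μ x * cdf μ y) := by
  have h : ∀ x, ∫ a, expKernel 0 (x - a) ∂μ = cdf μ x := by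
    intro x
    rw [cdf_eq_real, ← integral_indicator_one measurableSet_Iic]
    congr 1 with a
    simp [expKernel_zero_left, Set.indicator]
  have hmul : ∀ a, expKernel 0 (x - a) * expKernel 0 (y - a) = expKernel 0 (min x y - a) := by
    intro a
    simp only [expKernel_zero_left, sub_nonneg, le_min_iff]
    split_ifs <;> simp_all
  unfold kernelCov
  simp only [hmul, h, (monotone_cdf μ).map_min]

end DistanceVariance

/-! ### Log-concave functions: ratio monotonicity, exponential decay, second moments -/

section LogConcave

variable {f : ℝ → ℝ}

/-- The points t and a + δ are convex combinations of a and t + δ with interchanged weights, so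
multiplying the two log-concavity inequalities gives total exponent 1 at each endpoint. In effect
f(t + δ)/f(t) is nonincreasing in t. -/
lemma IsLogConcave.mul_add_le_mul_add (hf : IsLogConcave f) {a t δ : ℝ} (hat : a ≤ t) (hδ : 0 ≤ δ) :
    f a * f (t + δ) ≤ f t * f (a + δ) := by
  rcases hat.eq_or_lt with rfl | hat
  · exact le_rfl
  rcases hδ.eq_or_lt with rfl | hδ
  · simp [mul_comm]
  set d := t - a + δ with hd
  have hd0 : 0 < d := by linarith
  set α := δ / d
  set β := (t - a) / d
  have hα : 0 < α := by positivity
  have hβ : 0 < β := div_pos (by linarith) hd0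
  have hαd : α * d = δ := div_mul_cancel₀ _ hd0.ne'
  have hβd : β * d = t - a := div_mul_cancel₀ _ hd0.ne'
  have hs : α + β = 1 := by
    rw [← add_div, div_eq_one_iff_eq hd0.ne']
    linarith
  have hα' : α = 1 - β := by linarith
  have e1 : α * a + β * (t + δ) = t := by
    rw [hα']
    linear_combination hβd - β * hd
  have e2 : β * a + α * (t + δ) = a + δ := by
    have : β = 1 - α := by linarith
    rw [this]
    linear_combination hαd - α * hd
  have h1 := hf.2 a (t + δ) α β hα hβ hs
  have h2 := hf.2 a (t + δ) β α hβ hα (by linarith)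
  rw [e1] at h1
  rw [e2] at h2
  have n1 := hf.1 a
  have n2 := hf.1 (t + δ)
  calc f a * f (t + δ) = (f a ^ α * f (t + δ) ^ β) * (f a ^ β * f (t + δ) ^ α) := by
        rw [mul_mul_mul_comm, ← Real.rpow_add_of_nonneg n1 hα.le hβ.le,
          ← Real.rpow_add_of_nonneg n2 hβ.le hα.le, hs, add_comm β α, hs, Real.rpow_one,
          Real.rpow_one]
    _ ≤ f t * f (a + δ) :=
        mul_le_mul h1 h2 (mul_nonneg (Real.rpow_nonneg n1 _) (Real.rpow_nonneg n2 _)) (hf.1 t)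

lemma IsLogConcave.pos_of_mem_Icc (hf : IsLogConcave f) {l r z : ℝ} (hl : 0 < f l) (hr : 0 < f r)
    (hz : z ∈ Set.Icc l r) : 0 < f z := by
  rcases hz.1.eq_or_lt with rfl | h1
  · exact hl
  rcases hz.2.eq_or_lt with rfl | h2
  · exact hr
  have hd : 0 < r - l := by linarith
  have h := hf.2 l r ((r - z) / (r - l)) ((z - l) / (r - l)) (div_pos (by linarith) hd)
    (div_pos (by linarith) hd) (by field_simp; ring)
  have e : (r - z) / (r - l) * l + (z - l) / (r - l) * r = z := by
    field_simp
    ring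
  rw [e] at h
  exact lt_of_lt_of_le (by positivity) h

lemma IsLogConcave.comp_neg (hf : IsLogConcave f) : IsLogConcave fun x => f (-x) := by
  refine ⟨fun x => hf.1 _, fun x y a b ha hb hab => ?_⟩
  have := hf.2 (-x) (-y) a b ha hb hab
  convert this using 2
  ring

/-- An integrable log-concave function decays exponentially. -/
lemma IsLogConcave.exists_le_exp (hf : IsLogConcave f) (hi : Integrable f) {x₀ : ℝ}
    (h0 : 0 < f x₀) : ∃ C c x₁ : ℝ, 0 < c ∧ ∀ x > x₁, f x ≤ C * Real.exp (-c * x) := by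
  -- Otherwise f ≥ f x₀ on a half-line, contradicting integrability.
  obtain ⟨x₁, hx₁, hlt⟩ : ∃ x₁ > x₀, f x₁ < f x₀ := by
    by_contra! hcon
    have hc : IntegrableOn (fun _ : ℝ => f x₀) (Set.Ioi x₀) := by
      refine (hi.integrableOn (s := Set.Ioi x₀)).mono' aestronglyMeasurable_const ?_
      filter_upwards [ae_restrict_mem measurableSet_Ioi] with x hx
      rw [Real.norm_of_nonneg h0.le]
      exact hcon x hx
    rw [integrableOn_const_iff] at hc
    simp [h0.ne'] at hc
  -- The maximum with 1/2 keeps log r meaningful when f x₁ = 0.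
  set r := max (f x₁ / f x₀) (1 / 2)
  have hr0 : 0 < r := lt_max_of_lt_right (by norm_num)
  have hr1 : r < 1 := max_lt ((div_lt_one h0).2 hlt) (by norm_num)
  have hrf : f x₁ ≤ r * f x₀ := (div_le_iff₀ h0).1 (le_max_left _ _)
  have hL : 0 < x₁ - x₀ := by linarith
  set c := -Real.log r / (x₁ - x₀) with hcdef
  have hcL : Real.log r = -c * (x₁ - x₀) := by
    rw [hcdef]
    field_simp
  refine ⟨f x₀ * Real.exp (c * x₀), c, x₁, div_pos (neg_pos.2 (Real.log_neg hr0 hr1)) hL, ?_⟩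
  intro x hx
  have hd : 0 < x - x₀ := by linarith [hx.lt]
  -- The point x₁ is (1 - b) x₀ + b x, so log-concavity turns the drop from x₀ to x₁ into f x ≤ f x₀
  -- · r^{1/b}, and r^{1/b} = exp(-c (x - x₀)).
  set b := (x₁ - x₀) / (x - x₀) with hb
  have hb0 : 0 < b := by positivity
  have hb1 : b < 1 := (div_lt_one hd).2 (by linarith [hx.lt])
  have hbd : b * (x - x₀) = x₁ - x₀ := div_mul_cancel₀ _ hd.ne'
  have h := hf.2 x₀ x (1 - b) b (by linarith) hb0 (by ring)
  have e : (1 - b) * x₀ + b * x = x₁ := by linear_combination hbd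
  rw [e] at h
  have h2 : f x₀ ^ (1 - b) * f x ^ b ≤ f x₀ ^ (1 - b) * (r * f x₀ ^ b) := by
    refine (h.trans hrf).trans (le_of_eq ?_)
    rw [mul_left_comm, ← Real.rpow_add h0]
    simp
  have h3 : f x ^ b ≤ r * f x₀ ^ b := le_of_mul_le_mul_left h2 (by positivity)
  rw [mul_assoc, ← Real.exp_add, ← Real.rpow_le_rpow_iff (hf.1 x) (by positivity) hb0,
    Real.mul_rpow h0.le (Real.exp_pos _).le, ← Real.exp_mul]
  refine h3.trans (le_of_eq ?_)
  rw [mul_comm]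
  congr 1
  rw [← Real.exp_log hr0, hcL]
  congr 1
  linear_combination c * hbd

lemma IsLogConcave.integrableOn_sq_mul_Ioi (hf : IsLogConcave f) (hi : Integrable f) {x₀ : ℝ}
    (h0 : 0 < f x₀) : IntegrableOn (fun x => x ^ 2 * f x) (Set.Ioi 0) := by
  obtain ⟨C, c, x₁, hc, hle⟩ := hf.exists_le_exp hi h0
  have hsub : Set.Ioi (0 : ℝ) ⊆ Set.Icc 0 x₁ ∪ (Set.Ioi 0 ∩ Set.Ioi x₁) := by
    intro x hx
    rcases le_or_gt x x₁ with h | h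
    · exact Or.inl ⟨le_of_lt hx, h⟩
    · exact Or.inr ⟨hx, h⟩
  refine IntegrableOn.mono_set (IntegrableOn.union ?_ ?_) hsub
  · exact hi.integrableOn.continuousOn_mul (by fun_prop) isCompact_Icc
  · have h1 : IntegrableOn (fun x : ℝ => C * (x ^ (2 : ℝ) * Real.exp (-c * x ^ (1 : ℝ))))
        (Set.Ioi 0) :=
      (integrableOn_rpow_mul_exp_neg_mul_rpow (by norm_num) one_pos hc).const_mul C
    refine (h1.mono_set Set.inter_subset_left).mono'
      ((Measurable.aestronglyMeasurable (by fun_prop)).mul hi.1.restrict) ?_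
    filter_upwards [ae_restrict_mem (measurableSet_Ioi.inter measurableSet_Ioi)] with x hx
    rw [Real.norm_of_nonneg (mul_nonneg (sq_nonneg x) (hf.1 x)), Real.rpow_two, Real.rpow_one,
      mul_left_comm]
    exact mul_le_mul_of_nonneg_left (hle x hx.2) (sq_nonneg x)

lemma IsLogConcave.integrable_sq_mul (hf : IsLogConcave f) (hi : Integrable f) :
    Integrable fun x => x ^ 2 * f x := by
  by_cases h : ∃ x₀, 0 < f x₀
  · obtain ⟨x₀, h0⟩ := h
    have h1 := hf.integrableOn_sq_mul_Ioi hi h0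
    have h2 := hf.comp_neg.integrableOn_sq_mul_Ioi hi.comp_neg (x₀ := -x₀) (by simpa using h0)
    have h3 : IntegrableOn (fun x => x ^ 2 * f x) (Set.Iio 0) := by
      rw [show (0 : ℝ) = -0 by simp] at h2
      simpa using h2.comp_neg_Iio
    rw [← integrableOn_univ, ← Set.Iic_union_Ioi (a := (0 : ℝ))]
    exact ((integrableOn_Iic_iff_integrableOn_Iio).2 h3).union h1
  · push Not at h
    have : f = 0 := funext fun x => le_antisymm (h x) (hf.1 x)
    simp [this]

end LogConcave

/-! ### Distribution functions of log-concave laws -/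

section LogConcaveCDF

variable {f : ℝ → ℝ} {μ : Measure ℝ}

lemma measureReal_eq_setIntegral (hm : Measurable f) (h0 : ∀ x, 0 ≤ f x)
    (hμ : μ = (volume : Measure ℝ).withDensity (fun x => ENNReal.ofReal (f x)))
    {s : Set ℝ} (hs : MeasurableSet s) : μ.real s = ∫ x in s, f x := by
  rw [integral_eq_lintegral_of_nonneg_ae (.of_forall h0) hm.aestronglyMeasurable, measureReal_def,
    hμ, withDensity_apply _ hs]

lemma exists_pos_of_measureReal_pos (hm : Measurable f) (h0 : ∀ x, 0 ≤ f x)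
    (hμ : μ = (volume : Measure ℝ).withDensity (fun x => ENNReal.ofReal (f x)))
    {s : Set ℝ} (hs : MeasurableSet s) (hpos : 0 < μ.real s) : ∃ x ∈ s, 0 < f x := by
  by_contra! hcon
  rw [measureReal_eq_setIntegral hm h0 hμ hs, setIntegral_eq_zero_of_forall_eq_zero
    fun x hx => le_antisymm (hcon x hx) (h0 x)] at hpos
  exact lt_irrefl _ hpos

variable [IsProbabilityMeasure μ]

lemma integrable_of_withDensity_ofReal (hm : Measurable f) (h0 : ∀ x, 0 ≤ f x)
    (hμ : μ = (volume : Measure ℝ).withDensity (fun x => ENNReal.ofReal (f x))) :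
    Integrable f := by
  refine ⟨hm.aestronglyMeasurable, ?_⟩
  rw [hasFiniteIntegral_iff_ofReal (.of_forall h0), ← setLIntegral_univ,
    ← withDensity_apply _ MeasurableSet.univ, ← hμ]
  exact measure_lt_top _ _

lemma cdf_sub_cdf_eq_integral (hm : Measurable f) (h0 : ∀ x, 0 ≤ f x)
    (hμ : μ = (volume : Measure ℝ).withDensity (fun x => ENNReal.ofReal (f x))) (a b : ℝ) :
    cdf μ b - cdf μ a = ∫ x in a..b, f x := by
  have hi := integrable_of_withDensity_ofReal hm h0 hμ
  rw [cdf_eq_real, cdf_eq_real, measureReal_eq_setIntegral hm h0 hμ measurableSet_Iic,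
    measureReal_eq_setIntegral hm h0 hμ measurableSet_Iic,
    intervalIntegral.integral_Iic_sub_Iic hi.integrableOn hi.integrableOn]

lemma continuous_cdf_of_withDensity (hm : Measurable f) (h0 : ∀ x, 0 ≤ f x)
    (hμ : μ = (volume : Measure ℝ).withDensity (fun x => ENNReal.ofReal (f x))) :
    Continuous (cdf μ) := by
  have hi := integrable_of_withDensity_ofReal hm h0 hμ
  have : (cdf μ : ℝ → ℝ) = fun b => cdf μ 0 + ∫ x in (0 : ℝ)..b, f x := by
    ext b
    rw [← cdf_sub_cdf_eq_integral hm h0 hμ]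
    ring
  rw [this]
  exact continuous_const.add
    (intervalIntegral.continuous_primitive (fun _ _ => hi.intervalIntegrable) 0)

/-- There is mass on both sides of a, hence points with f > 0 at or left of a and strictly right of
a; log-concavity fills the interval between them. -/
lemma exists_gt_and_pos_on_Icc (hm : Measurable f) (hf : IsLogConcave f)
    (hμ : μ = (volume : Measure ℝ).withDensity (fun x => ENNReal.ofReal (f x))) {a : ℝ}
    (ha : cdf μ a ∈ Set.Ioo (0 : ℝ) 1) : ∃ r > a, ∀ x ∈ Set.Icc a r, 0 < f x := by
  have h1 : 0 < μ.real (Set.Iic a) := by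
    rw [← cdf_eq_real]
    exact ha.1
  have h2 : 0 < μ.real (Set.Ioi a) := by
    rw [← Set.compl_Iic, probReal_compl_eq_one_sub measurableSet_Iic, ← cdf_eq_real]
    linarith [ha.2]
  obtain ⟨l, hl, hfl⟩ := exists_pos_of_measureReal_pos hm hf.1 hμ measurableSet_Iic h1
  obtain ⟨r, hr, hfr⟩ := exists_pos_of_measureReal_pos hm hf.1 hμ measurableSet_Ioi h2
  exact ⟨r, hr, fun x hx => hf.pos_of_mem_Icc hfl hfr ⟨le_trans hl hx.1, hx.2⟩⟩

lemma cdf_lt_cdf_of_mem_Ioo (hm : Measurable f) (hf : IsLogConcave f)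
    (hμ : μ = (volume : Measure ℝ).withDensity (fun x => ENNReal.ofReal (f x))) {a b : ℝ}
    (ha : cdf μ a ∈ Set.Ioo (0 : ℝ) 1) (hab : a < b) : cdf μ a < cdf μ b := by
  have hi := integrable_of_withDensity_ofReal hm hf.1 hμ
  obtain ⟨r, hr, hpos⟩ := exists_gt_and_pos_on_Icc hm hf hμ ha
  have hac : a < min b r := lt_min hab hr
  have h := intervalIntegral.intervalIntegral_pos_of_pos_on (f := f) (a := a) (b := min b r)
    hi.intervalIntegrable (fun x hx => hpos x ⟨hx.1.le, hx.2.le.trans (min_le_right _ _)⟩) hac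
  rw [← cdf_sub_cdf_eq_integral hm hf.1 hμ] at h
  have := monotone_cdf μ (min_le_left b r)
  linarith

/-- `F(· + δ)` lies below an affine function of `F`, with equality at `a`. -/
lemma exists_cdf_add_sub_le (hm : Measurable f) (hf : IsLogConcave f)
    (hμ : μ = (volume : Measure ℝ).withDensity (fun x => ENNReal.ofReal (f x))) {a δ : ℝ}
    (ha : 0 < f a) (hδ : 0 ≤ δ) :
    ∃ c : ℝ, ∀ x, cdf μ (x + δ) - cdf μ (a + δ) ≤ c * (cdf μ x - cdf μ a) := by
  have hi := integrable_of_withDensity_ofReal hm hf.1 hμ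
  have hi' : Integrable fun x => f (x + δ) := hi.comp_add_right δ
  -- This is the slope at a of F(· + δ) as a function of F. The ratio f(t + δ)/f(t) is at most this
  -- for t ≥ a and at least this for t ≤ a where f t > 0, which gives the bound on both sides.
  refine ⟨f (a + δ) / f a, fun x => ?_⟩
  rw [cdf_sub_cdf_eq_integral hm hf.1 hμ, cdf_sub_cdf_eq_integral hm hf.1 hμ,
    ← intervalIntegral.integral_comp_add_right, ← intervalIntegral.integral_const_mul]
  rcases le_total a x with hx | hx
  · refine intervalIntegral.integral_mono_on hx hi'.intervalIntegrable
      (hi.intervalIntegrable.const_mul _) fun t ht => ?_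
    rw [div_mul_eq_mul_div, le_div_iff₀ ha]
    linarith [hf.mul_add_le_mul_add ht.1 hδ]
  · rw [intervalIntegral.integral_symm, intervalIntegral.integral_symm x a, neg_le_neg_iff]
    refine intervalIntegral.integral_mono_on hx (hi.intervalIntegrable.const_mul _)
      hi'.intervalIntegrable fun t ht => ?_
    rw [div_mul_eq_mul_div, div_le_iff₀ ha]
    linarith [hf.mul_add_le_mul_add ht.2 hδ]

/-- A probability measure with log-concave density has a finite second moment. -/
lemma memLp_two_id_of_isLogConcave (hm : Measurable f) (hf : IsLogConcave f)
    (hμ : μ = (volume : Measure ℝ).withDensity (fun x => ENNReal.ofReal (f x))) :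
    MemLp id 2 μ := by
  have hi := integrable_of_withDensity_ofReal hm hf.1 hμ
  rw [memLp_two_iff_integrable_sq measurable_id.aestronglyMeasurable, hμ,
    integrable_withDensity_iff hm.ennreal_ofReal (.of_forall fun x => ENNReal.ofReal_lt_top)]
  simpa [ENNReal.toReal_ofReal (hf.1 _)] using hf.integrable_sq_mul hi

end LogConcaveCDF

/-! ### Convolution and the dispersive order -/

section Convolution

lemma integrable_cdf_sub (μ : Measure ℝ) {ν : Measure ℝ} [IsProbabilityMeasure ν] (u : ℝ) : Integrable (fun y => cdf μ (u - y)) ν := by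
  have hmeas : Measurable fun y => cdf μ (u - y) :=
    (monotone_cdf μ).measurable.comp (by fun_prop)
  refine Integrable.of_bound hmeas.aestronglyMeasurable 1 (.of_forall fun y => ?_)
  rw [Real.norm_of_nonneg (cdf_nonneg _ _)]
  exact cdf_le_one _ _

variable {μ ν : Measure ℝ} [IsProbabilityMeasure μ] [IsProbabilityMeasure ν]

lemma cdf_conv (u : ℝ) : cdf (μ ∗ ν) u = ∫ y, cdf μ (u - y) ∂ν := by
  have hmeas : Measurable fun y => cdf μ (u - y) :=
    (monotone_cdf μ).measurable.comp (by fun_prop)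
  rw [integral_eq_lintegral_of_nonneg_ae (.of_forall fun y => cdf_nonneg _ _)
    hmeas.aestronglyMeasurable, cdf_eq_real, measureReal_def, Measure.conv,
    Measure.map_apply (by fun_prop) measurableSet_Iic,
    Measure.prod_apply_symm (measurableSet_Iic.preimage (by fun_prop))]
  congr 1
  refine lintegral_congr fun y => ?_
  rw [ofReal_cdf]
  congr 1
  ext x
  simp [le_sub_iff_add_le]

lemma continuous_cdf_conv (hF : Continuous (cdf μ)) : Continuous (cdf (μ ∗ ν)) := by
  have : (cdf (μ ∗ ν) : ℝ → ℝ) = fun u => ∫ y, cdf μ (u - y) ∂ν := funext cdf_conv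
  rw [this]
  refine continuous_of_dominated (bound := fun _ => 1) (fun u => (integrable_cdf_sub μ u).1)
    (fun u => .of_forall fun y => ?_) (integrable_const _) (.of_forall fun y => by fun_prop)
  rw [Real.norm_of_nonneg (cdf_nonneg _ _)]
  exact cdf_le_one _ _

/-- Convolution increases a log-concave law in the dispersive order. -/
lemma cdf_conv_add_le {f : ℝ → ℝ} (hm : Measurable f) (hf : IsLogConcave f)
    (hμ : μ = (volume : Measure ℝ).withDensity (fun x => ENNReal.ofReal (f x))) {a u δ : ℝ}
    (ha : 0 < f a) (hδ : 0 ≤ δ) (h : cdf μ a = cdf (μ ∗ ν) u) :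
    cdf (μ ∗ ν) (u + δ) ≤ cdf μ (a + δ) := by
  obtain ⟨c, hc⟩ := exists_cdf_add_sub_le hm hf hμ ha hδ
  -- The affine bound at x = u - y is averaged over y. Its right side becomes c (G u - F a) = 0,
  -- with G the distribution function of μ ∗ ν.
  have key : ∫ y, (cdf μ (u + δ - y) - cdf μ (a + δ)) ∂ν ≤
      ∫ y, c * (cdf μ (u - y) - cdf μ a) ∂ν := by
    refine integral_mono ((integrable_cdf_sub μ _).sub (integrable_const _))
      (((integrable_cdf_sub μ _).sub (integrable_const _)).const_mul c) fun y => ?_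
    have := hc (u - y)
    rwa [sub_add_eq_add_sub] at this
  rw [integral_const_mul, integral_sub (integrable_cdf_sub μ _) (integrable_const _),
    integral_sub (integrable_cdf_sub μ _) (integrable_const _), ← cdf_conv, ← cdf_conv] at key
  simp only [integral_const, probReal_univ, one_smul] at key
  rw [h, sub_self, mul_zero] at key
  linarith

end Convolution

/-! ### Integral comparison under the dispersive order -/

section Dispersive

/-- If the quantile function of `G` spreads points more than that of `F`, then integrals
along `F` are dominated by integrals along `G`. -/
lemma lintegral_comp_le_of_dispersive {F G : ℝ → ℝ} (hF : Measurable F) (hG : Measurable G)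
    (hF01 : ∀ x, F x ∈ Set.Icc (0 : ℝ) 1)
    (hGF : ∀ v, G v ∈ Set.Ioo (0 : ℝ) 1 → ∃ a, F a = G v)
    (hFG : ∀ a, F a ∈ Set.Ioo (0 : ℝ) 1 → ∃ v, G v = F a)
    (hdisp : ∀ u v a b, u ≤ v → G u ∈ Set.Ioo (0 : ℝ) 1 → G v ∈ Set.Ioo (0 : ℝ) 1 →
      F a = G u → F b = G v → |b - a| ≤ v - u)
    {φ : ℝ → ℝ≥0∞} (hφ : Measurable φ) (h0 : φ 0 = 0) (h1 : φ 1 = 0) :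
    ∫⁻ x, φ (F x) ≤ ∫⁻ v, φ (G v) := by
  set I := F ⁻¹' Set.Ioo 0 1
  set J := G ⁻¹' Set.Ioo 0 1
  have hI : MeasurableSet I := hF measurableSet_Ioo
  have hJ : MeasurableSet J := hG measurableSet_Ioo
  -- T is the transport map F⁻¹ ∘ G, which `hdisp` makes 1-Lipschitz on J; the Lipschitz extension S
  -- to the whole line is continuous, hence measurable.
  choose! T hT using hGF
  have hTlip : LipschitzOnWith 1 T J := by
    refine LipschitzOnWith.of_dist_le_mul fun u hu v hv => ?_
    rw [NNReal.coe_one, one_mul, Real.dist_eq, Real.dist_eq]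
    rcases le_total u v with huv | huv
    · rw [abs_sub_comm, abs_sub_comm u v, abs_of_nonneg (sub_nonneg.2 huv)]
      exact hdisp u v _ _ huv hu hv (hT u hu) (hT v hv)
    · rw [abs_of_nonneg (sub_nonneg.2 huv)]
      exact hdisp v u _ _ huv hv hu (hT v hv) (hT u hu)
  obtain ⟨S, hS, hST⟩ := hTlip.extend_real
  have hFS : ∀ v ∈ J, F (S v) = G v := fun v hv => by rw [← hST hv, hT v hv]
  -- S maps J onto I without increasing length, so the push-forward of Lebesgue measure on J
  -- dominates Lebesgue measure on I.
  have hdom : volume.restrict I ≤ (volume.restrict J).map S := by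
    refine Measure.le_iff.2 fun A hA => ?_
    rw [Measure.map_apply hS.continuous.measurable hA, Measure.restrict_apply hA,
      Measure.restrict_apply (hS.continuous.measurable hA)]
    have hsub : A ∩ I ⊆ S '' (S ⁻¹' A ∩ J) := by
      rintro a ⟨haA, haI⟩
      obtain ⟨v, hv⟩ := hFG a haI
      have hvJ : v ∈ J := by
        show G v ∈ Set.Ioo (0 : ℝ) 1
        rw [hv]
        exact haI
      -- Taking u = v in `hdisp` shows that F is injective over the levels attained by G in (0, 1),
      -- so S v is a itself.
      have := hdisp v v a (S v) le_rfl hvJ hvJ hv.symm (hFS v hvJ)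
      rw [sub_self, abs_nonpos_iff, sub_eq_zero] at this
      refine ⟨v, ⟨?_, hvJ⟩, this⟩
      rw [Set.mem_preimage, this]
      exact haA
    refine (measure_mono hsub).trans ?_
    have := hS.hausdorffMeasure_image_le (d := 1) zero_le_one (S ⁻¹' A ∩ J)
    simpa [hausdorffMeasure_real] using this
  calc ∫⁻ x, φ (F x) = ∫⁻ x in I, φ (F x) := by
        refine (setLIntegral_eq_of_support_subset ?_).symm
        intro x hx
        rw [Function.mem_support] at hx
        have h01 := hF01 x
        refine ⟨h01.1.lt_of_ne fun h => hx (by rw [← h, h0]), h01.2.lt_of_ne fun h => hx ?_⟩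
        rw [h, h1]
    _ ≤ ∫⁻ x, φ (F x) ∂((volume.restrict J).map S) := lintegral_mono' hdom le_rfl
    _ = ∫⁻ v in J, φ (F (S v)) := lintegral_map (hφ.comp hF) hS.continuous.measurable
    _ = ∫⁻ v in J, φ (G v) := setLIntegral_congr_fun hJ fun v hv => by simp only [hFS v hv]
    _ ≤ ∫⁻ v, φ (G v) := setLIntegral_le_lintegral _ _

lemma exists_cdf_eq {μ : Measure ℝ} (hc : Continuous (cdf μ)) {p : ℝ}
    (hp : p ∈ Set.Ioo (0 : ℝ) 1) : ∃ a, cdf μ a = p :=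
  mem_range_of_exists_le_of_exists_ge hc
    (((tendsto_cdf_atBot μ).eventually (eventually_le_nhds hp.1)).exists)
    (((tendsto_cdf_atTop μ).eventually (eventually_ge_nhds hp.2)).exists)

variable {μ ν : Measure ℝ} [IsProbabilityMeasure μ] [IsProbabilityMeasure ν]

lemma lintegral_comp_cdf_le_conv {f : ℝ → ℝ} (hm : Measurable f) (hf : IsLogConcave f)
    (hμ : μ = (volume : Measure ℝ).withDensity (fun x => ENNReal.ofReal (f x)))
    {φ : ℝ → ℝ≥0∞} (hφ : Measurable φ) (h0 : φ 0 = 0) (h1 : φ 1 = 0) :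
    ∫⁻ x, φ (cdf μ x) ≤ ∫⁻ v, φ (cdf (μ ∗ ν) v) := by
  have hFc := continuous_cdf_of_withDensity hm hf.1 hμ
  have hGc : Continuous (cdf (μ ∗ ν)) := continuous_cdf_conv hFc
  refine lintegral_comp_le_of_dispersive hFc.measurable hGc.measurable
    (fun x => ⟨cdf_nonneg _ _, cdf_le_one _ _⟩) (fun v hv => exists_cdf_eq hFc hv)
    (fun a ha => exists_cdf_eq hGc ha) ?_ hφ h0 h1
  intro u v a b huv hu hv ha hb
  have haI : cdf μ a ∈ Set.Ioo (0 : ℝ) 1 := ha ▸ hu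
  have hbI : cdf μ b ∈ Set.Ioo (0 : ℝ) 1 := hb ▸ hv
  have hab : a ≤ b := by
    by_contra! hba
    have h1 := cdf_lt_cdf_of_mem_Ioo hm hf hμ hbI hba
    have h2 := monotone_cdf (μ ∗ ν) huv
    linarith
  rw [abs_of_nonneg (sub_nonneg.2 hab)]
  obtain ⟨r, hr, hpos⟩ := exists_gt_and_pos_on_Icc hm hf hμ haI
  have h3 := cdf_conv_add_le hm hf hμ (hpos a ⟨le_rfl, hr.le⟩) (sub_nonneg.2 huv) ha
  rw [add_sub_cancel, ← hb] at h3
  by_contra! hlt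
  have h4 : a + (v - u) < b := by linarith
  -- F is strictly increasing only from points with level in (0, 1), so this level must be located
  -- before strictness contradicts `h3`.
  have haI' : cdf μ (a + (v - u)) ∈ Set.Ioo (0 : ℝ) 1 :=
    ⟨hbI.1.trans_le h3, (monotone_cdf μ h4.le).trans_lt hbI.2⟩
  exact absurd h3 (cdf_lt_cdf_of_mem_Ioo hm hf hμ haI' h4).not_ge

/-- The integrand depends only on the two levels and vanishes when either is 0 or 1, so the
one-variable comparison replaces F by G first in y, then in x. -/
lemma lintegral_kernelCov_zero_le_conv {f : ℝ → ℝ} (hm : Measurable f) (hf : IsLogConcave f)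
    (hμ : μ = (volume : Measure ℝ).withDensity (fun x => ENNReal.ofReal (f x))) :
    ∫⁻ x, ∫⁻ y, ENNReal.ofReal (kernelCov μ 0 x y ^ 2) ≤
      ∫⁻ x, ∫⁻ y, ENNReal.ofReal (kernelCov (μ ∗ ν) 0 x y ^ 2) := by
  simp only [kernelCov_zero]
  set h : ℝ → ℝ → ℝ≥0∞ := fun p q => ENNReal.ofReal ((2 * (min p q - p * q)) ^ 2) with hh
  have hhm : Measurable (Function.uncurry h) := by
    simp only [hh, Function.uncurry_def]
    fun_prop
  have l0 : ∀ q ∈ Set.Icc (0 : ℝ) 1, h 0 q = 0 := fun q hq => by simp [hh, hq.1]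
  have l1 : ∀ q ∈ Set.Icc (0 : ℝ) 1, h 1 q = 0 := fun q hq => by simp [hh, hq.2]
  have r0 : ∀ p ∈ Set.Icc (0 : ℝ) 1, h p 0 = 0 := fun q hq => by simp [hh, hq.1]
  have r1 : ∀ p ∈ Set.Icc (0 : ℝ) 1, h p 1 = 0 := fun q hq => by simp [hh, hq.2]
  have hcdf : ∀ (ρ : Measure ℝ) x, cdf ρ x ∈ Set.Icc (0 : ℝ) 1 :=
    fun ρ x => ⟨cdf_nonneg _ _, cdf_le_one _ _⟩
  have hGm : Measurable (cdf (μ ∗ ν)) := (monotone_cdf _).measurable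
  calc ∫⁻ x, ∫⁻ y, h (cdf μ x) (cdf μ y)
      ≤ ∫⁻ x, ∫⁻ v, h (cdf μ x) (cdf (μ ∗ ν) v) := by
        refine lintegral_mono fun x => ?_
        exact lintegral_comp_cdf_le_conv hm hf hμ
          (hhm.comp (by fun_prop : Measurable fun q : ℝ => (cdf μ x, q)))
          (r0 _ (hcdf _ _)) (r1 _ (hcdf _ _))
    _ ≤ ∫⁻ u, ∫⁻ v, h (cdf (μ ∗ ν) u) (cdf (μ ∗ ν) v) := by
        refine lintegral_comp_cdf_le_conv hm hf hμ
          (φ := fun p => ∫⁻ v, h p (cdf (μ ∗ ν) v)) ?_ ?_ ?_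
        · exact (hhm.comp (by fun_prop : Measurable fun z : ℝ × ℝ =>
            (z.1, cdf (μ ∗ ν) z.2))).lintegral_prod_right'
        · simp [l0 _ (hcdf _ _)]
        · simp [l1 _ (hcdf _ _)]

end Dispersive

/-! ### Comparison of the distance standard deviations -/

theorem mainTheorem11 {Ω : Type*} [MeasurableSpace Ω] (P : Measure Ω) [IsProbabilityMeasure P]
    (X : Ω → ℝ) (hX : AEMeasurable X P) (hdens : HasLogConcaveDensity X P)
    (Y : Ω → ℝ) (hY : AEMeasurable Y P) (hXY : IndepFun X Y P) :
    distanceStd X P ≤ distanceStd (fun ω => X ω + Y ω) P := by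
  obtain ⟨f, hm, hf, hμ⟩ := hdens
  have := Measure.isProbabilityMeasure_map hX
  have := Measure.isProbabilityMeasure_map hY
  have hconv : P.map (fun ω => X ω + Y ω) = P.map X ∗ P.map Y :=
    hXY.map_add_eq_map_conv_map₀ hX hY
  refine ENNReal.rpow_le_rpow ?_ (by norm_num)
  calc distanceVariance X P
      = ∫⁻ x, ∫⁻ y, ENNReal.ofReal (kernelCov (P.map X) 0 x y ^ 2) :=
        distanceVariance_eq_lintegral hX (memLp_two_id_of_isLogConcave hm hf hμ)
    _ ≤ ∫⁻ x, ∫⁻ y, ENNReal.ofReal (kernelCov (P.map (fun ω => X ω + Y ω)) 0 x y ^ 2) := by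
        rw [hconv]
        exact lintegral_kernelCov_zero_le_conv hm hf hμ
    _ ≤ distanceVariance (fun ω => X ω + Y ω) P := lintegral_le_distanceVariance (hX.add hY)
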